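/- Let $d\in\{2,3\}$, $m\ge 2$ and $\nu>0$. There are constants $\eta_0>0$ and $C>0$, depending only on $d$, $m$ and $\nu$ (in particular not on the mesh size), such that the following holds. Let $\Omega\subset\mathbb R^d$ be a bounded domain (non-empty, open, connected) that is the interior of its closure (for instance, one with Lipschitz boundary), and let $\mathcal T_h$ be a finite conforming triangulation of $\Omega$ into open triangles ($d=2$) or tetrahedra ($d=3$) that is quasi-uniform with constant $\nu$: $\max_{K}h_K\le \nu\min_{K}\rho_K$, where $h_K=\operatorname{diam}K$ and $\rho_K$ is the diameter of the largest ball inscribed in $K$. Let $\mathcal E_h$ be the set of all $(d-1)$-dimensional faces and $h_e=\operatorname{diam} e$. *Reconstructed space.* For $K\in\mathcal T_h$ let $S_0(K)=\{K\}$, let $S_{t+1}(K)$ be the set of all elements whose closure meets the closure of some element of $S_t(K)$, and let the patch $S(K)$ be the first $S_t(K)$ with at least $s$ elements, where $s\le\#\mathcal T_h$ is a given threshold. Let $\mathbf x_L$ be the barycenter of $L$. Assume that, for every $K$, a polynomial of degree at most $m$ that vanishes at $\mathbf x_L$ for all $L\in S(K)$ vanishes on $S(K)$. For a piecewise constant field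 $\mathbf g_h$ with values in $\mathbb R^d$ let $\mathcal R\mathbf g_h$ be the piecewise polynomial field whose restriction to each $K$ is that of the minimizer of $\sum_{L\in S(K)}|\mathbf q(\mathbf x_L)-\mathbf g_h(\mathbf x_L)|^2$ over all polynomial fields $\mathbf q$ of degree at most $m$ with $\mathbf q(\mathbf x_K)=\mathbf g_h(\mathbf x_K)$. Let $\mathbf U_h^m$ be the set of all $\mathcal R\mathbf g_h$. *Notation.* All curls are taken element by element. For $d=2$, $\operatorname{curl}\mathbf u=\partial_xu_2-\partial_yu_1$, $\operatorname{curl}q=(\partial_yq,-\partial_xq)$ for scalar $q$, $\mathbf a\times\mathbf b=a_1b_2-a_2b_1$, and $q\times\mathbf n=(-n_2q,\,n_1q)$ for scalar $q$; for $d=3$ curl and cross product are the usual ones. On an interior face $e$, shared by $K^+$ and $K^-$ with outward unit normals $\mathbf n^\pm$, put $[\![\mathbf u]\!]=\mathbf u|_{K^+}\times\mathbf n^++\mathbf u|_{K^-}\times\mathbf n^-$, $[\![\operatorname{curl}\mathbf u]\!]=\operatorname{curl}\mathbf u|_{K^+}\times\mathbf n^++\operatorname{curl}\mathbf u|_{K^-}\times\mathbf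 n^-$ and $\{v\}=\tfrac12(v|_{K^+}+v|_{K^-})$; on a boundary face of $K$ with outward unit normal $\mathbf n$, put $[\![\mathbf u]\!]=\mathbf u|_K\times\mathbf n$, $[\![\operatorname{curl}\mathbf u]\!]=\operatorname{curl}\mathbf u|_K\times\mathbf n$ and $\{v\}=v|_K$. For a penalty parameter $\eta$ let $$\begin{aligned}B_h(\mathbf u,\mathbf v)={}&\sum_{K\in\mathcal T_h}\int_K\big(\operatorname{curl}^2\mathbf u\cdot\operatorname{curl}^2\mathbf v+\mathbf u\cdot\mathbf v\big)\,dx\\&+\sum_{e\in\mathcal E_h}\int_e\big([\![\mathbf u]\!]\cdot\{\operatorname{curl}^3\mathbf v\}+[\![\operatorname{curl}\mathbf u]\!]\cdot\{\operatorname{curl}^2\mathbf v\}\big)\,ds\\&+\sum_{e\in\mathcal E_h}\int_e\big([\![\mathbf v]\!]\cdot\{\operatorname{curl}^3\mathbf u\}+[\![\operatorname{curl}\mathbf v]\!]\cdot\{\operatorname{curl}^2\mathbf u\}\big)\,ds\\&+\sum_{e\in\mathcal E_h}\int_e\big(\eta h_e^{-3}[\![\mathbf u]\!]\cdot[\![\mathbf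 v]\!]+\eta h_e^{-1}[\![\operatorname{curl}\mathbf u]\!]\cdot[\![\operatorname{curl}\mathbf v]\!]\big)\,ds\end{aligned}$$ and $$\begin{aligned}|||\mathbf u|||^2={}&\sum_{K\in\mathcal T_h}\int_K\big(|\mathbf u|^2+|\operatorname{curl}^2\mathbf u|^2\big)\,dx+\sum_{e\in\mathcal E_h}\int_e\big(h_e^{-3}|[\![\mathbf u]\!]|^2+h_e^{-1}|[\![\operatorname{curl}\mathbf u]\!]|^2\big)\,ds\\&+\sum_{e\in\mathcal E_h}\int_e\big(h_e^{3}|\{\operatorname{curl}^3\mathbf u\}|^2+h_e|\{\operatorname{curl}^2\mathbf u\}|^2\big)\,ds.\end{aligned}$$ *Claim.* For every $\eta\ge\eta_0$, $$B_h(\mathbf u_h,\mathbf u_h)\ \ge\ C\,|||\mathbf u_h|||^2\qquad\text{for all }\mathbf u_h\in\mathbf U_h^m .$$ -/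

import Mathlib

open MeasureTheory

noncomputable section

namespace CurlDG

/-- The Euclidean space `ℝ^d`. -/
abbrev Space (d : ℕ) : Type := EuclideanSpace ℝ (Fin d)

/-! ### Cross products and curls in dimensions two and three

For `d = 2` the curl of a vector field is a scalar; scalars are written as vectors with one
component. For `d = 3` the curl of a vector field is a vector field. -/

/-- Number of components of the curl of a vector field on `ℝ^d`: one for `d = 2`, and `d` for
`d = 3`. -/
abbrev curlDim : ℕ → ℕ
  | 2 => 1
  | d => d

/-- The values of `a × b` for `a, b ∈ ℝ^d`, and of the curl of a vector field on `ℝ^d`: scalars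
for `d = 2`, vectors for `d = 3`. -/
abbrev CurlSpace (d : ℕ) : Type := Space (curlDim d)

/-- The cross product `a × b` of two vectors of `ℝ^d`, `d ∈ {2, 3}` (zero for other `d`). -/
def cross : (d : ℕ) → Space d → Space d → CurlSpace d
  | 2, a, b => !₂[a 0 * b 1 - a 1 * b 0]
  | 3, a, b => !₂[a 1 * b 2 - a 2 * b 1, a 2 * b 0 - a 0 * b 2, a 0 * b 1 - a 1 * b 0]
  | _, _, _ => 0

/-- The cross product `q × b` of a value `q` of a curl and a vector `b`. For `d = 2`, `q` is a
scalar and `q × b = - b × q` with `b × q = (b₂ q, - b₁ q)`; for `d = 3` it is the cross product of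
`ℝ^3`. -/
def curlCross : (d : ℕ) → CurlSpace d → Space d → Space d
  | 2, q, b => !₂[-(b 1 * q 0), b 0 * q 0]
  | 3, q, b => !₂[q 1 * b 2 - q 2 * b 1, q 2 * b 0 - q 0 * b 2, q 0 * b 1 - q 1 * b 0]
  | _, _, _ => 0

/-- The partial derivative `∂f/∂x_i` at `x`. -/
def pd {d : ℕ} (i : Fin d) (f : Space d → ℝ) (x : Space d) : ℝ :=
  fderiv ℝ f x (EuclideanSpace.single i 1)

/-- The curl of a vector field on `ℝ^d`, `d ∈ {2, 3}`. -/
def curl : (d : ℕ) → (Space d → Space d) → Space d → CurlSpace d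
  | 2, u, x => !₂[pd 0 (fun y => u y 1) x - pd 1 (fun y => u y 0) x]
  | 3, u, x =>
      !₂[pd 1 (fun y => u y 2) x - pd 2 (fun y => u y 1) x,
         pd 2 (fun y => u y 0) x - pd 0 (fun y => u y 2) x,
         pd 0 (fun y => u y 1) x - pd 1 (fun y => u y 0) x]
  | _, _, _ => 0

/-- The curl of a field that is itself the curl of a vector field: for `d = 2` the formal adjoint
`∇ × q = (∂q/∂y, - ∂q/∂x)` of the curl, for `d = 3` the curl again. -/
def curlAdj : (d : ℕ) → (Space d → CurlSpace d) → Space d → Space d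
  | 2, q, x => !₂[pd 1 (fun y => q y 0) x, -pd 0 (fun y => q y 0) x]
  | 3, q, x =>
      !₂[pd 1 (fun y => q y 2) x - pd 2 (fun y => q y 1) x,
         pd 2 (fun y => q y 0) x - pd 0 (fun y => q y 2) x,
         pd 0 (fun y => q y 1) x - pd 1 (fun y => q y 0) x]
  | _, _, _ => 0

/-- `curl² u`. -/
def curl2 {d : ℕ} (u : Space d → Space d) : Space d → Space d := curlAdj d (curl d u)

/-- `curl³ u`. -/
def curl3 {d : ℕ} (u : Space d → Space d) : Space d → CurlSpace d := curl d (curl2 u)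

/-! ### Simplices and meshes -/

/-- The closed simplex (element or face) with vertex set `K`. -/
def hull {d : ℕ} (K : Finset (Space d)) : Set (Space d) := convexHull ℝ (K : Set (Space d))

/-- The diameter `h_K` (or `h_e`) of the simplex with vertex set `K`. -/
def size {d : ℕ} (K : Finset (Space d)) : ℝ := Metric.diam (hull K)

/-- `ρ_K`, the diameter of the largest ball inscribed in the simplex with vertex set `K`. -/
def inscribed {d : ℕ} (K : Finset (Space d)) : ℝ :=
  sSup {δ : ℝ | ∃ (x : Space d) (r : ℝ), 0 ≤ r ∧ δ = 2 * r ∧ Metric.closedBall x r ⊆ hull K}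

/-- The barycenter of the simplex with vertex set `K`. -/
def barycenter {d : ℕ} (K : Finset (Space d)) : Space d := (K.card : ℝ)⁻¹ • ∑ x ∈ K, x

/-- A finite conforming triangulation of `Ω ⊆ ℝ^d` by `d`-simplices, each given by its set of
vertices. The element is the interior of the simplex. -/
structure Mesh {d : ℕ} (Ω : Set (Space d)) where
  cells : Finset (Finset (Space d))
  card_eq : ∀ K ∈ cells, K.card = d + 1
  indep : ∀ K ∈ cells, AffineIndependent ℝ (fun x : K => (x : Space d))
  conforming : ∀ K ∈ cells, ∀ L ∈ cells,
    hull K ∩ hull L = convexHull ℝ ((K : Set (Space d)) ∩ (L : Set (Space d)))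
  cover : ⋃ K ∈ cells, hull K = closure Ω

variable {d : ℕ} {Ω : Set (Space d)}

/-- Quasi-uniformity with constant `ν`: `max_K h_K ≤ ν min_K ρ_K`. -/
def Mesh.QuasiUniform (T : Mesh Ω) (ν : ℝ) : Prop :=
  ∀ K ∈ T.cells, ∀ L ∈ T.cells, size K ≤ ν * inscribed L

open Classical in
/-- The set `E_h` of all `(d-1)`-dimensional faces, each given by its `d` vertices. -/
def Mesh.faces (T : Mesh Ω) : Finset (Finset (Space d)) :=
  T.cells.biUnion fun K => K.powersetCard d

open Classical in
/-- The elements that have `e` as a face: two, `K⁺` and `K⁻`, for an interior face, and one for a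
boundary face. -/
def Mesh.adj (T : Mesh Ω) (e : Finset (Space d)) : Finset (Finset (Space d)) :=
  T.cells.filter fun K => e ⊆ K

/-- The unit normal on the face `e` of the simplex `K`, pointing out of `K`: the normalized
component orthogonal to `e` of the vector from the barycenter of `K` to the barycenter of `e`. -/
def normal (K e : Finset (Space d)) : Space d :=
  let w := (vectorSpan ℝ (e : Set (Space d)))ᗮ.starProjection (barycenter e - barycenter K)
  ‖w‖⁻¹ • w

/-- The `(d-1)`-dimensional surface measure. -/
def surface (d : ℕ) : Measure (Space d) := Measure.euclideanHausdorffMeasure (d - 1)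

/-! ### Piecewise fields, jumps and averages -/

/-- A piecewise field with respect to a mesh: for every element `K` a field `u K`, whose restriction
to the closure of `K` is the restriction of the piecewise field, with its one-sided traces on
the faces of `K`. The values of `u K` outside the closure of `K`, and `u K` for a `K` that is not
an element, are irrelevant. -/
abbrev Broken (d : ℕ) (F : Type) : Type := Finset (Space d) → Space d → F

/-- The jump `⟦u⟧ = u|_{K⁺} × n⁺ + u|_{K⁻} × n⁻` on an interior face, `u|_K × n` on a boundary
face. -/
def jump (T : Mesh Ω) (u : Broken d (Space d)) (e : Finset (Space d)) (x : Space d) :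
    CurlSpace d :=
  ∑ K ∈ T.adj e, cross d (u K x) (normal K e)

/-- The jump `⟦curl u⟧ = curl u|_{K⁺} × n⁺ + curl u|_{K⁻} × n⁻` on an interior face,
`curl u|_K × n` on a boundary face. -/
def jumpCurl (T : Mesh Ω) (u : Broken d (Space d)) (e : Finset (Space d)) (x : Space d) :
    Space d :=
  ∑ K ∈ T.adj e, curlCross d (curl d (u K) x) (normal K e)

/-- The average `(v|_{K⁺} + v|_{K⁻}) / 2` on an interior face, `v|_K` on a boundary face. -/
def avg {n : ℕ} (T : Mesh Ω) (v : Broken d (Space n)) (e : Finset (Space d)) (x : Space d) :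
    Space n :=
  ((T.adj e).card : ℝ)⁻¹ • ∑ K ∈ T.adj e, v K x

/-- The average of `curl² u`. -/
def avgCurl2 (T : Mesh Ω) (u : Broken d (Space d)) : Finset (Space d) → Space d → Space d :=
  avg T fun K => curl2 (u K)

/-- The average of `curl³ u`. -/
def avgCurl3 (T : Mesh Ω) (u : Broken d (Space d)) : Finset (Space d) → Space d → CurlSpace d :=
  avg T fun K => curl3 (u K)

/-! ### The bilinear form and the energy norms -/

/-- The symmetric interior penalty bilinear form `B_h` with penalty `η`, that is, with
`μ₁ = η / h_e³` and `μ₂ = η / h_e` on the face `e`. -/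
def form (T : Mesh Ω) (η : ℝ) (u v : Broken d (Space d)) : ℝ :=
  (∑ K ∈ T.cells, ∫ x in hull K, inner ℝ (curl2 (u K) x) (curl2 (v K) x))
  + (∑ K ∈ T.cells, ∫ x in hull K, inner ℝ (u K x) (v K x))
  + (∑ e ∈ T.faces, ∫ x in hull e,
      (inner ℝ (jump T u e x) (avgCurl3 T v e x) + inner ℝ (jumpCurl T u e x) (avgCurl2 T v e x))
      ∂(surface d))
  + (∑ e ∈ T.faces, ∫ x in hull e,
      (inner ℝ (jump T v e x) (avgCurl3 T u e x) + inner ℝ (jumpCurl T v e x) (avgCurl2 T u e x))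
      ∂(surface d))
  + (∑ e ∈ T.faces, ∫ x in hull e,
      ((η / size e ^ 3) * inner ℝ (jump T u e x) (jump T v e x)
        + (η / size e) * inner ℝ (jumpCurl T u e x) (jumpCurl T v e x)) ∂(surface d))

/-- The square of the energy norm made of the `L²` norms of `u` and of the piecewise `curl² u`,
and of the scaled jumps of `u` and `curl u`. -/
def dgNormSq (T : Mesh Ω) (u : Broken d (Space d)) : ℝ :=
  (∑ K ∈ T.cells, ∫ x in hull K, ‖u K x‖ ^ 2)
  + (∑ K ∈ T.cells, ∫ x in hull K, ‖curl2 (u K) x‖ ^ 2)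
  + (∑ e ∈ T.faces, ∫ x in hull e, (size e ^ 3)⁻¹ * ‖jump T u e x‖ ^ 2 ∂(surface d))
  + (∑ e ∈ T.faces, ∫ x in hull e, (size e)⁻¹ * ‖jumpCurl T u e x‖ ^ 2 ∂(surface d))

/-- The square of the stronger energy norm `|||u|||`, which also contains the scaled averages of
`curl³ u` and `curl² u`. -/
def energyNormSq (T : Mesh Ω) (u : Broken d (Space d)) : ℝ :=
  dgNormSq T u
  + (∑ e ∈ T.faces, ∫ x in hull e, size e ^ 3 * ‖avgCurl3 T u e x‖ ^ 2 ∂(surface d))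
  + (∑ e ∈ T.faces, ∫ x in hull e, size e * ‖avgCurl2 T u e x‖ ^ 2 ∂(surface d))

/-! ### The reconstructed space -/

open Classical in
/-- The layers `S_t(K)`: `S_0(K) = {K}`, and `S_{t+1}(K)` consists of the elements whose closure
meets the closure of an element of `S_t(K)`. -/
def Mesh.layer (T : Mesh Ω) (K : Finset (Space d)) : ℕ → Finset (Finset (Space d))
  | 0 => {K}
  | t + 1 => T.cells.filter fun L => ∃ K' ∈ Mesh.layer T K t, (hull K' ∩ hull L).Nonempty

/-- The element patch `S(K)` with threshold `s`: the first layer with at least `s` elements. -/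
def Mesh.patch (T : Mesh Ω) (s : ℕ) (K : Finset (Space d)) : Finset (Finset (Space d)) :=
  T.layer K (sInf {t | s ≤ (T.layer K t).card})

/-- `p` is a polynomial function on `ℝ^d` of total degree at most `m`. -/
def IsPoly (m : ℕ) (p : Space d → ℝ) : Prop :=
  ∃ P : MvPolynomial (Fin d) ℝ, P.totalDegree ≤ m ∧
    ∀ x : Space d, p x = MvPolynomial.eval (fun i => x i) P

/-- `q` is a vector field on `ℝ^d` whose components are polynomials of degree at most `m`. -/
def IsPolyField (m : ℕ) (q : Space d → Space d) : Prop :=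
  ∀ i : Fin d, IsPoly m fun x => q x i

/-- The geometrical assumption on the collocation points: on every patch `S(K)`, a polynomial of
degree at most `m` that vanishes at the barycenters of the elements of `S(K)` vanishes on
`S(K)`. -/
def Mesh.Unisolvent (T : Mesh Ω) (m s : ℕ) : Prop :=
  ∀ K ∈ T.cells, ∀ p : Space d → ℝ, IsPoly m p →
    (∀ L ∈ T.patch s K, p (barycenter L) = 0) → ∀ L ∈ T.patch s K, ∀ x ∈ hull L, p x = 0

/-- `q` solves the constrained least squares problem on the patch `S(K)` for the piecewise constant
field with value `g L` on the element `L`: among the polynomial fields of degree at most `m` that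
take the value `g K` at the barycenter of `K`, it minimizes the sum over the collocation points of
the squared distances to the piecewise constant field. -/
def Mesh.IsLeastSquares (T : Mesh Ω) (m s : ℕ) (g : Finset (Space d) → Space d)
    (K : Finset (Space d)) (q : Space d → Space d) : Prop :=
  IsPolyField m q ∧ q (barycenter K) = g K ∧
    ∀ q' : Space d → Space d, IsPolyField m q' → q' (barycenter K) = g K →
      ∑ L ∈ T.patch s K, ‖q (barycenter L) - g L‖ ^ 2
        ≤ ∑ L ∈ T.patch s K, ‖q' (barycenter L) - g L‖ ^ 2

/-- The reconstructed space `U_h^m`: the image of the piecewise constant fields under the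
reconstruction operator, which replaces a piecewise constant field on each element `K` by the
solution of the least squares problem on the patch `S(K)`. -/
def Mesh.reconstructed (T : Mesh Ω) (m s : ℕ) : Set (Broken d (Space d)) :=
  {u | ∃ g : Finset (Space d) → Space d, ∀ K ∈ T.cells, T.IsLeastSquares m s g K (u K)}

end CurlDG

end

/-!
The restriction of a reconstructed field to an element is a polynomial field of degree at most `m`.
Nothing else about the reconstruction matters: the form is coercive on all broken polynomial fields.

Write `A` for the `L²` norms of `u` and of the piecewise `curl² u`, `J` for the scaled jumps and `M`
for the scaled averages of `curl³ u` and `curl² u`, all squared, so that `|||u|||² = A + J + M`. In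
`B_h(u, u)` the consistency terms are twice the pairing of jumps with averages, and since the
weights `h_e³` and `h_e` of the averages are inverse to those of the jumps, Young's inequality
(`neg_le_two_mul_integral_face`) bounds them below by `-(ε M + J / ε)`. The averages satisfy
`M ≤ C ‖curl² u‖²` (`exists_avg_integral_le`), so with `ε = 1 / (2 C)` the term `ε M` is absorbed by
half of `‖curl² u‖²`, the term `J / ε` by the penalty, and `M` itself by `A`
(`inv_mul_energyNormSq_le_form`).

The estimate of `M` is an inverse trace inequality on one element (`exists_face_integral_le`),
applied to the polynomial field `w = curl² u`. It does not use a reference simplex. By shape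
regularity a simplex lies between two concentric balls whose radii `r` and `4 ν r` have a fixed
ratio. On the finite-dimensional space of polynomials of degree at most `m` the `L²` norm on the
unit ball controls the values and the first derivatives on any larger ball; scaling gives
`|w|² + r² |∇w|² ≤ C r^{-d} ∫_K |w|²` on all of `K` (`exists_sq_le_integral_ball`). This is
integrated over a face, whose surface measure is at most a constant times `h_e^{d-1}`
(`exists_surface_hull_le`).
-/

namespace CurlDG

open MeasureTheory Metric

/-! ### Polynomial functions on `ℝ^d` -/

section Polynomials

variable {d m : ℕ}

lemma IsPoly.add {p q : Space d → ℝ} (hp : IsPoly m p) (hq : IsPoly m q) :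
    IsPoly m fun x => p x + q x := by
  obtain ⟨P, hP, hPe⟩ := hp
  obtain ⟨Q, hQ, hQe⟩ := hq
  exact ⟨P + Q, (MvPolynomial.totalDegree_add P Q).trans (max_le hP hQ), fun x => by simp [hPe, hQe]⟩

lemma IsPoly.neg {p : Space d → ℝ} (hp : IsPoly m p) : IsPoly m fun x => -p x := by
  obtain ⟨P, hP, hPe⟩ := hp
  exact ⟨-P, (MvPolynomial.totalDegree_neg P).trans_le hP, fun x => by simp [hPe]⟩

lemma IsPoly.sub {p q : Space d → ℝ} (hp : IsPoly m p) (hq : IsPoly m q) :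
    IsPoly m fun x => p x - q x := by
  simpa only [sub_eq_add_neg] using hp.add hq.neg

lemma IsPoly.continuous {p : Space d → ℝ} (hp : IsPoly m p) : Continuous p := by
  obtain ⟨P, -, hPe⟩ := hp
  rw [funext hPe]
  exact P.continuous_eval.comp (by fun_prop)

lemma hasFDerivAt_eval (P : MvPolynomial (Fin d) ℝ) (x : Space d) :
    HasFDerivAt (fun y : Space d => MvPolynomial.eval (fun i => y i) P)
      (∑ i, MvPolynomial.eval (fun j => x j) (MvPolynomial.pderiv i P) •
        (EuclideanSpace.proj i : Space d →L[ℝ] ℝ)) x := by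
  induction P using MvPolynomial.induction_on with
  | C a => simpa using hasFDerivAt_const a x
  | add p q hp hq =>
    simp only [map_add, add_smul, Finset.sum_add_distrib]
    exact hp.add hq
  | mul_X p n hp =>
    have hX : HasFDerivAt (fun y : Space d => y n) (EuclideanSpace.proj n : Space d →L[ℝ] ℝ) x :=
      (EuclideanSpace.proj n : Space d →L[ℝ] ℝ).hasFDerivAt
    simp only [map_mul, MvPolynomial.eval_X]
    refine (hp.mul hX).congr_fderiv ?_
    ext v
    simp [MvPolynomial.pderiv_X, Pi.single_apply, add_mul, Finset.sum_add_distrib,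
      Finset.mul_sum, apply_ite, mul_assoc]

lemma totalDegree_pderiv_le (i : Fin d) (P : MvPolynomial (Fin d) ℝ) :
    (MvPolynomial.pderiv i P).totalDegree ≤ P.totalDegree := by
  refine Finset.sup_le fun s hs => ?_
  rw [MvPolynomial.mem_support_iff, MvPolynomial.coeff_pderiv] at hs
  have h := MvPolynomial.le_totalDegree (MvPolynomial.mem_support_iff.2 (left_ne_zero_of_mul hs))
  rw [Finsupp.sum_add_index' (by simp) (by simp)] at h
  exact (Nat.le_add_right _ _).trans h

lemma pd_eval (P : MvPolynomial (Fin d) ℝ) (i : Fin d) (x : Space d) :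
    pd i (fun y : Space d => MvPolynomial.eval (fun j => y j) P) x =
      MvPolynomial.eval (fun j => x j) (MvPolynomial.pderiv i P) := by
  simp [pd, (hasFDerivAt_eval P x).fderiv]

lemma IsPoly.pd {p : Space d → ℝ} (hp : IsPoly m p) (i : Fin d) : IsPoly m (pd i p) := by
  obtain ⟨P, hP, hPe⟩ := hp
  exact ⟨MvPolynomial.pderiv i P, (totalDegree_pderiv_le i P).trans hP, fun x => by
    rw [funext hPe, pd_eval]⟩

lemma IsPoly.differentiable {p : Space d → ℝ} (hp : IsPoly m p) : Differentiable ℝ p := by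
  obtain ⟨P, -, hPe⟩ := hp
  rw [funext hPe]
  exact fun x => (hasFDerivAt_eval P x).differentiableAt

lemma IsPoly.comp_affine {p : Space d → ℝ} (hp : IsPoly m p) (c : Space d) (r : ℝ) :
    IsPoly m fun x => p (c + r • x) := by
  obtain ⟨P, hP, hPe⟩ := hp
  set X : Fin d → MvPolynomial (Fin d) ℝ :=
    fun i => MvPolynomial.C (c i) + MvPolynomial.C r * MvPolynomial.X i with hX
  have hX1 : ∀ i, (X i).totalDegree ≤ 1 := fun i => by
    refine (MvPolynomial.totalDegree_add _ _).trans (max_le (by simp) ?_)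
    exact (MvPolynomial.totalDegree_mul _ _).trans (by simp)
  refine ⟨MvPolynomial.eval₂ MvPolynomial.C X P, ?_, fun x => ?_⟩
  · rw [MvPolynomial.eval₂_eq']
    refine MvPolynomial.totalDegree_finsetSum_le fun s hs => ?_
    refine (MvPolynomial.totalDegree_mul _ _).trans ?_
    rw [MvPolynomial.totalDegree_C, zero_add]
    refine (MvPolynomial.totalDegree_finsetProd _ _).trans ?_
    calc ∑ i, (X i ^ s i).totalDegree ≤ ∑ i, s i :=
          Finset.sum_le_sum fun i _ => (MvPolynomial.totalDegree_pow _ _).trans <| by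
            simpa using Nat.mul_le_mul_left (s i) (hX1 i)
      _ = s.sum fun _ e => e := (Finsupp.sum_fintype s (fun _ e => e) fun _ => rfl).symm
      _ ≤ m := (MvPolynomial.le_totalDegree hs).trans hP
  · beta_reduce
    rw [hPe, MvPolynomial.eval₂_eq', MvPolynomial.eval_eq']
    simp [hX]

lemma pd_comp_affine {p : Space d → ℝ} (hp : IsPoly m p) (c : Space d) (r : ℝ) (i : Fin d)
    (x : Space d) : pd i (fun y => p (c + r • y)) x = r * pd i p (c + r • x) := by
  have h1 : HasFDerivAt (fun y : Space d => c + r • y) (r • ContinuousLinearMap.id ℝ (Space d)) x :=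
    ((hasFDerivAt_id x).const_smul r).const_add c
  have h2 := (hp.differentiable (c + r • x)).hasFDerivAt.comp x h1
  unfold CurlDG.pd
  change fderiv ℝ (p ∘ fun y : Space d => c + r • y) x _ = _
  rw [h2.fderiv]
  simp

/-- A polynomial that vanishes on the unit ball is zero, since the ball contains a product of
infinite sets. -/
lemma eq_zero_of_eval_eq_zero_on_ball {P : MvPolynomial (Fin d) ℝ}
    (h : ∀ x ∈ ball (0 : Space d) 1, MvPolynomial.eval (fun i => x i) P = 0) : P = 0 := by
  have hn : ball (0 : Space d) 1 ∈ nhds (0 : Space d) := ball_mem_nhds _ one_pos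
  have hc : Continuous (fun y : Fin d → ℝ => (WithLp.toLp 2 y : Space d)) :=
    PiLp.continuous_toLp 2 _
  have hn' := hc.continuousAt.preimage_mem_nhds (x := 0) (by simpa using hn)
  obtain ⟨ε, hε, hb⟩ := Metric.mem_nhds_iff.1 hn'
  refine MvPolynomial.funext_set (fun _ => Set.Ioo (-ε) ε)
    (fun _ => Set.Ioo_infinite (by linarith)) fun y hy => ?_
  have hy' : y ∈ ball (0 : Fin d → ℝ) ε := by
    rw [mem_ball_zero_iff, pi_norm_lt_iff hε]
    exact fun i => abs_lt.2 (hy i trivial)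
  simpa using h _ (hb hy')

end Polynomials

/-! ### Norm equivalence on polynomials -/

/-- On a finite-dimensional space a positive definite form controls every linear map. -/
lemma exists_norm_sq_le_of_posDef {V F : Type*} [AddCommGroup V] [Module ℝ V]
    [FiniteDimensional ℝ V] [NormedAddCommGroup F] [NormedSpace ℝ F] (B : V →ₗ[ℝ] V →ₗ[ℝ] ℝ)
    (hsymm : ∀ v w, B v w = B w v) (hnonneg : ∀ v, 0 ≤ B v v) (hdef : ∀ v, B v v = 0 → v = 0)
    (L : V →ₗ[ℝ] F) : ∃ C : ℝ, 0 ≤ C ∧ ∀ v, ‖L v‖ ^ 2 ≤ C * B v v := by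
  let core : InnerProductSpace.Core ℝ V :=
    { inner := fun v w => B v w
      conj_inner_symm := fun v w => hsymm w v
      re_inner_nonneg := hnonneg
      add_left := fun u v w => by simp
      smul_left := fun u v r => by simp
      definite := hdef }
  let _ : NormedAddCommGroup V := core.toNormedAddCommGroup
  let _ : InnerProductSpace ℝ V := InnerProductSpace.ofCore core.toCore
  let L' : V →L[ℝ] F := LinearMap.toContinuousLinearMap L
  refine ⟨‖L'‖ ^ 2, by positivity, fun v => ?_⟩
  have h1 : ‖v‖ ^ 2 = B v v := (real_inner_self_eq_norm_sq v).symm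
  rw [← h1, ← mul_pow]
  exact pow_le_pow_left₀ (norm_nonneg _) (L'.le_opNorm v) 2

section NormEquivalence

variable {d : ℕ}

lemma integrableOn_of_continuous {f : Space d → ℝ} (hf : Continuous f) (x : Space d) (r : ℝ) :
    IntegrableOn f (closedBall x r) :=
  hf.continuousOn.integrableOn_compact (isCompact_closedBall x r)

lemma continuous_eval_space (P : MvPolynomial (Fin d) ℝ) :
    Continuous fun x : Space d => MvPolynomial.eval (fun i => x i) P :=
  P.continuous_eval.comp (by fun_prop)

/-- The `L²` inner product over the unit ball, on polynomials of degree at most `m`. -/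
noncomputable def ballForm (d m : ℕ) : MvPolynomial.restrictTotalDegree (Fin d) ℝ m →ₗ[ℝ]
    MvPolynomial.restrictTotalDegree (Fin d) ℝ m →ₗ[ℝ] ℝ :=
  LinearMap.mk₂ ℝ (fun P Q => ∫ x in closedBall (0 : Space d) 1,
      MvPolynomial.eval (fun i => x i) P.1 * MvPolynomial.eval (fun i => x i) Q.1)
    (fun P P' Q => by
      simp only [Submodule.coe_add, map_add, add_mul]
      exact integral_add
        (integrableOn_of_continuous ((continuous_eval_space _).mul (continuous_eval_space _)) _ _)
        (integrableOn_of_continuous ((continuous_eval_space _).mul (continuous_eval_space _)) _ _))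
    (fun c P Q => by
      simp only [Submodule.coe_smul, MvPolynomial.smul_eval, mul_assoc, smul_eq_mul]
      exact integral_const_mul _ _)
    (fun P Q Q' => by
      simp only [Submodule.coe_add, map_add, mul_add]
      exact integral_add
        (integrableOn_of_continuous ((continuous_eval_space _).mul (continuous_eval_space _)) _ _)
        (integrableOn_of_continuous ((continuous_eval_space _).mul (continuous_eval_space _)) _ _))
    (fun c P Q => by
      simp only [Submodule.coe_smul, MvPolynomial.smul_eval, mul_left_comm, smul_eq_mul]
      exact integral_const_mul _ _)

lemma ballForm_self (m : ℕ) (P : MvPolynomial.restrictTotalDegree (Fin d) ℝ m) :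
    ballForm d m P P =
      ∫ x in closedBall (0 : Space d) 1, MvPolynomial.eval (fun i => x i) P.1 ^ 2 := by
  simp [ballForm, sq]

lemma ballForm_definite (m : ℕ) (P : MvPolynomial.restrictTotalDegree (Fin d) ℝ m)
    (h : ballForm d m P P = 0) : P = 0 := by
  rw [ballForm_self] at h
  have hc : Continuous fun x : Space d => MvPolynomial.eval (fun i => x i) P.1 ^ 2 :=
    (continuous_eval_space P.1).pow 2
  have h0 : ∫ x in ball (0 : Space d) 1, MvPolynomial.eval (fun i => x i) P.1 ^ 2 = 0 := by
    refine le_antisymm ?_ (integral_nonneg fun x => sq_nonneg _)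
    rw [← h]
    exact setIntegral_mono_set (integrableOn_of_continuous hc _ _)
      (Filter.Eventually.of_forall fun x => sq_nonneg _)
      (LE.le.eventuallyLE ball_subset_closedBall)
  rw [setIntegral_eq_zero_iff_of_nonneg_ae (Filter.Eventually.of_forall fun x => sq_nonneg _)
    ((integrableOn_of_continuous hc _ _).mono_set ball_subset_closedBall)] at h0
  refine Subtype.ext (eq_zero_of_eval_eq_zero_on_ball fun x hx => ?_)
  have := Measure.eqOn_open_of_ae_eq h0 isOpen_ball hc.continuousOn continuousOn_const hx
  simpa using this

/-- Restriction of a polynomial to a closed ball, as a continuous function. -/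
noncomputable def evalOnBall (d : ℕ) (R : ℝ) :
    MvPolynomial (Fin d) ℝ →ₗ[ℝ] C(closedBall (0 : Space d) R, ℝ) where
  toFun P := ⟨fun x => MvPolynomial.eval (fun i => x.1 i) P,
    (continuous_eval_space P).comp continuous_subtype_val⟩
  map_add' P Q := by ext; simp
  map_smul' c P := by ext; simp [MvPolynomial.smul_eval]

/-- Values and first derivatives of a polynomial on a large ball are controlled by its `L²` norm
on the unit ball. -/
lemma exists_sq_le_integral_unitBall (d m : ℕ) (R : ℝ) :
    ∃ C : ℝ, 0 ≤ C ∧ ∀ p : Space d → ℝ, IsPoly m p → ∀ y ∈ closedBall (0 : Space d) R,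
      p y ^ 2 ≤ C * ∫ x in closedBall (0 : Space d) 1, p x ^ 2 ∧
      ∀ i, pd i p y ^ 2 ≤ C * ∫ x in closedBall (0 : Space d) 1, p x ^ 2 := by
  have key : ∀ L : MvPolynomial.restrictTotalDegree (Fin d) ℝ m →ₗ[ℝ] MvPolynomial (Fin d) ℝ,
      ∃ C : ℝ, 0 ≤ C ∧ ∀ P, ∀ y ∈ closedBall (0 : Space d) R,
        MvPolynomial.eval (fun i => y i) (L P) ^ 2 ≤ C * ballForm d m P P := fun L => by
    obtain ⟨C, hC, h⟩ := exists_norm_sq_le_of_posDef (ballForm d m)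
      (fun P Q => by simp [ballForm, mul_comm])
      (fun P => by rw [ballForm_self]; exact integral_nonneg fun x => sq_nonneg _)
      (ballForm_definite m) (evalOnBall d R ∘ₗ L)
    refine ⟨C, hC, fun P y hy => le_trans ?_ (h P)⟩
    have := ContinuousMap.norm_coe_le_norm (evalOnBall d R (L P)) ⟨y, hy⟩
    simpa [evalOnBall] using pow_le_pow_left₀ (norm_nonneg _) this 2
  obtain ⟨C₀, hC₀, h₀⟩ := key (Submodule.subtype _)
  choose C₁ hC₁ h₁ using fun i : Fin d =>
    key ((MvPolynomial.pderiv i).toLinearMap ∘ₗ Submodule.subtype _)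
  refine ⟨C₀ + ∑ i, C₁ i, add_nonneg hC₀ (Finset.sum_nonneg fun i _ => hC₁ i), ?_⟩
  rintro p ⟨P, hP, hPe⟩ y hy
  have hPm : P ∈ MvPolynomial.restrictTotalDegree (Fin d) ℝ m :=
    (MvPolynomial.mem_restrictTotalDegree _ _ _).2 hP
  have hI : ∫ x in closedBall (0 : Space d) 1, p x ^ 2 = ballForm d m ⟨P, hPm⟩ ⟨P, hPm⟩ := by
    rw [ballForm_self]; simp only [hPe]
  have hI0 : 0 ≤ ∫ x in closedBall (0 : Space d) 1, p x ^ 2 := integral_nonneg fun x => sq_nonneg _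
  refine ⟨?_, fun i => ?_⟩
  · have h := h₀ ⟨P, hPm⟩ y hy
    rw [← hI] at h
    rw [hPe]
    exact h.trans (mul_le_mul_of_nonneg_right
      (le_add_of_nonneg_right (Finset.sum_nonneg fun i _ => hC₁ i)) hI0)
  · have h := h₁ i ⟨P, hPm⟩ y hy
    rw [← hI] at h
    rw [funext hPe, pd_eval, ← funext hPe]
    refine h.trans (mul_le_mul_of_nonneg_right ?_ hI0)
    have := Finset.single_le_sum (f := C₁) (fun i _ => hC₁ i) (Finset.mem_univ i)
    linarith

lemma setIntegral_closedBall_comp_affine (f : Space d → ℝ) (c : Space d) {r : ℝ} (hr : 0 < r) :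
    ∫ x in closedBall (0 : Space d) 1, f (c + r • x) =
      (r ^ d)⁻¹ * ∫ x in closedBall c r, f x := by
  have h1 := Measure.setIntegral_comp_smul_of_pos (volume : Measure (Space d))
    (fun x => f (c + x)) (closedBall 0 1) hr
  rw [h1, smul_eq_mul, finrank_euclideanSpace_fin, smul_unitClosedBall_of_nonneg hr.le]
  congr 1
  have h2 := (measurePreserving_add_left (volume : Measure (Space d)) c).setIntegral_preimage_emb
    (measurableEmbedding_addLeft c) f (closedBall c r)
  rw [← h2]
  congr 2
  ext x
  simp [dist_eq_norm]

/-- The scaled form of `exists_sq_le_integral_unitBall`: each derivative costs one power of the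
radius. -/
lemma exists_sq_le_integral_ball (d m : ℕ) (R : ℝ) :
    ∃ C : ℝ, 0 ≤ C ∧ ∀ p : Space d → ℝ, IsPoly m p → ∀ (c : Space d) (r : ℝ), 0 < r →
      ∀ y ∈ closedBall c (R * r),
      p y ^ 2 ≤ C * ((r ^ d)⁻¹ * ∫ x in closedBall c r, p x ^ 2) ∧
      ∀ i, r ^ 2 * pd i p y ^ 2 ≤ C * ((r ^ d)⁻¹ * ∫ x in closedBall c r, p x ^ 2) := by
  obtain ⟨C, hC, h⟩ := exists_sq_le_integral_unitBall d m R
  refine ⟨C, hC, fun p hp c r hr y hy => ?_⟩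
  have hz : r⁻¹ • (y - c) ∈ closedBall (0 : Space d) R := by
    rw [mem_closedBall, dist_eq_norm] at hy
    rw [mem_closedBall_zero_iff, norm_smul, norm_inv, Real.norm_of_nonneg hr.le,
      inv_mul_le_iff₀ hr, mul_comm]
    exact hy
  have hyz : c + r • (r⁻¹ • (y - c)) = y := by
    rw [smul_smul, mul_inv_cancel₀ hr.ne', one_smul, add_sub_cancel]
  have := h _ (hp.comp_affine c r) _ hz
  rw [setIntegral_closedBall_comp_affine (fun x => p x ^ 2) c hr, hyz] at this
  refine ⟨this.1, fun i => ?_⟩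
  have h2 := this.2 i
  rwa [pd_comp_affine hp, hyz, mul_pow] at h2

end NormEquivalence

/-! ### Curls of polynomial fields -/

section Curls

variable {d m : ℕ}

lemma IsPolyField.continuous {q : Space d → Space d} (hq : IsPolyField m q) : Continuous q :=
  (PiLp.continuous_toLp 2 _).comp (continuous_pi fun i => (hq i).continuous)

lemma isPoly_curl (hd : d = 2 ∨ d = 3) {u : Space d → Space d} (hu : IsPolyField m u)
    (i : Fin (curlDim d)) : IsPoly m fun x => curl d u x i := by
  rcases hd with rfl | rfl
  · fin_cases i
    exact ((hu 1).pd 0).sub ((hu 0).pd 1)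
  · fin_cases i
    · exact ((hu 2).pd 1).sub ((hu 1).pd 2)
    · exact ((hu 0).pd 2).sub ((hu 2).pd 0)
    · exact ((hu 1).pd 0).sub ((hu 0).pd 1)

lemma isPolyField_curlAdj (hd : d = 2 ∨ d = 3) {q : Space d → CurlSpace d}
    (hq : ∀ i, IsPoly m fun x => q x i) : IsPolyField m (curlAdj d q) := by
  rcases hd with rfl | rfl
  · intro i
    fin_cases i
    · exact (hq 0).pd 1
    · exact ((hq 0).pd 0).neg
  · intro i
    fin_cases i
    · exact ((hq 2).pd 1).sub ((hq 1).pd 2)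
    · exact ((hq 0).pd 2).sub ((hq 2).pd 0)
    · exact ((hq 1).pd 0).sub ((hq 0).pd 1)

lemma isPolyField_curl2 (hd : d = 2 ∨ d = 3) {u : Space d → Space d} (hu : IsPolyField m u) :
    IsPolyField m (curl2 u) :=
  isPolyField_curlAdj hd (isPoly_curl hd hu)

lemma continuous_curl (hd : d = 2 ∨ d = 3) {u : Space d → Space d} (hu : IsPolyField m u) :
    Continuous (curl d u) :=
  (PiLp.continuous_toLp 2 _).comp (continuous_pi fun i => (isPoly_curl hd hu i).continuous)

lemma continuous_cross (hd : d = 2 ∨ d = 3) {u : Space d → Space d} (hu : Continuous u)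
    (b : Space d) : Continuous fun x => cross d (u x) b := by
  have h : ∀ i, Continuous fun x => u x i := fun i => by fun_prop
  rcases hd with rfl | rfl
  · refine (PiLp.continuous_toLp 2 _).comp (continuous_pi fun i => ?_)
    fin_cases i
    exact ((h 0).mul_const _).sub ((h 1).mul_const _)
  · refine (PiLp.continuous_toLp 2 _).comp (continuous_pi fun i => ?_)
    fin_cases i
    · exact ((h 1).mul_const _).sub ((h 2).mul_const _)
    · exact ((h 2).mul_const _).sub ((h 0).mul_const _)
    · exact ((h 0).mul_const _).sub ((h 1).mul_const _)

lemma continuous_curlCross (hd : d = 2 ∨ d = 3) {q : Space d → CurlSpace d} (hq : Continuous q)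
    (b : Space d) : Continuous fun x => curlCross d (q x) b := by
  have h : ∀ i, Continuous fun x => q x i := fun i => by fun_prop
  rcases hd with rfl | rfl
  · refine (PiLp.continuous_toLp 2 _).comp (continuous_pi fun i => ?_)
    fin_cases i
    · exact ((h 0).const_mul _).neg
    · exact (h 0).const_mul _
  · refine (PiLp.continuous_toLp 2 _).comp (continuous_pi fun i => ?_)
    fin_cases i
    · exact ((h 1).mul_const _).sub ((h 2).mul_const _)
    · exact ((h 2).mul_const _).sub ((h 0).mul_const _)
    · exact ((h 0).mul_const _).sub ((h 1).mul_const _)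

lemma norm_sq_curl_le (hd : d = 2 ∨ d = 3) (w : Space d → Space d) (x : Space d) :
    ‖curl d w x‖ ^ 2 ≤ 2 * ∑ j, ∑ i, pd i (fun y => w y j) x ^ 2 := by
  have key : ∀ a b : ℝ, (a - b) ^ 2 ≤ 2 * a ^ 2 + 2 * b ^ 2 := fun a b => by
    linarith [sq_nonneg (a + b)]
  have h0 : ∀ i j, 0 ≤ pd i (fun y => w y j) x ^ 2 := fun i j => sq_nonneg _
  rcases hd with rfl | rfl
  · rw [EuclideanSpace.real_norm_sq_eq]
    have h1 := key (pd 0 (fun y => w y 1) x) (pd 1 (fun y => w y 0) x)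
    have : ∑ i : Fin (curlDim 2), curl 2 w x i ^ 2 =
        (pd 0 (fun y => w y 1) x - pd 1 (fun y => w y 0) x) ^ 2 := Fin.sum_univ_one _
    rw [this]
    simp only [Fin.sum_univ_two]
    linarith [h0 0 0, h0 1 1]
  · rw [EuclideanSpace.real_norm_sq_eq]
    have h1 := key (pd 1 (fun y => w y 2) x) (pd 2 (fun y => w y 1) x)
    have h2 := key (pd 2 (fun y => w y 0) x) (pd 0 (fun y => w y 2) x)
    have h3 := key (pd 0 (fun y => w y 1) x) (pd 1 (fun y => w y 0) x)
    have : ∑ i : Fin (curlDim 3), curl 3 w x i ^ 2 =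
        (pd 1 (fun y => w y 2) x - pd 2 (fun y => w y 1) x) ^ 2 +
        (pd 2 (fun y => w y 0) x - pd 0 (fun y => w y 2) x) ^ 2 +
        (pd 0 (fun y => w y 1) x - pd 1 (fun y => w y 0) x) ^ 2 := Fin.sum_univ_three _
    rw [this]
    simp only [Fin.sum_univ_three]
    linarith [h0 0 0, h0 1 1, h0 2 2]

end Curls

/-! ### Faces and inscribed balls -/

section Geometry

variable {d : ℕ}

lemma isCompact_hull (K : Finset (Space d)) : IsCompact (hull K) :=
  K.finite_toSet.isCompact_convexHull (𝕜 := ℝ)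

lemma hull_mono {e K : Finset (Space d)} (h : e ⊆ K) : hull e ⊆ hull K :=
  convexHull_mono (Finset.coe_subset.2 h)

lemma size_mono {e K : Finset (Space d)} (h : e ⊆ K) : size e ≤ size K :=
  diam_mono (hull_mono h) (isCompact_hull K).isBounded

lemma size_pos {e : Finset (Space d)} (h : 1 < e.card) : 0 < size e := by
  obtain ⟨a, ha, b, hb, hab⟩ := Finset.one_lt_card.1 h
  exact (dist_pos.2 hab).trans_le (dist_le_diam_of_mem (isCompact_hull e).isBounded
    (subset_convexHull ℝ _ ha) (subset_convexHull ℝ _ hb))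

/-- A face lies in an isometric copy of a ball of `ℝ^(d-1)` with radius its diameter. -/
lemma exists_surface_hull_le (d : ℕ) : ∃ A : ℝ, 0 ≤ A ∧ ∀ e : Finset (Space d), e.card = d →
    e.Nonempty → AffineIndependent ℝ (fun x : e => (x : Space d)) →
    surface d (hull e) ≤ ENNReal.ofReal (A * size e ^ (d - 1)) := by
  set B := volume (ball (0 : Space (d - 1)) 1) with hB
  have hBt : B ≠ ⊤ := measure_ball_lt_top.ne
  refine ⟨B.toReal, ENNReal.toReal_nonneg, fun e hcard hne hind => ?_⟩
  obtain ⟨x₀, hx₀⟩ := hne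
  have hpos : 0 < e.card := Finset.card_pos.2 ⟨x₀, hx₀⟩
  have hfin : Module.finrank ℝ (vectorSpan ℝ (e : Set (Space d))) = d - 1 := by
    have h := hind.finrank_vectorSpan (n := d - 1) (by rw [Fintype.card_coe]; omega)
    have hr : Set.range (fun x : e => (x : Space d)) = (e : Set (Space d)) := Subtype.range_coe
    rwa [hr] at h
  let φ := ((stdOrthonormalBasis ℝ (vectorSpan ℝ (e : Set (Space d)))).reindex
    (finCongr hfin)).repr
  let f : Space (d - 1) → Space d := fun z => (φ.symm z : Space d) + x₀
  have hf : Isometry f := (isometry_add_right x₀).comp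
    ((vectorSpan ℝ (e : Set (Space d))).subtypeₗᵢ.isometry.comp φ.symm.isometry)
  have hsub : hull e ⊆ f '' closedBall 0 (size e) := fun x hx => by
    have hx₀' : x₀ ∈ hull e := subset_convexHull ℝ _ hx₀
    have hv : x - x₀ ∈ vectorSpan ℝ (e : Set (Space d)) := by
      rw [← direction_affineSpan]
      exact AffineSubspace.vsub_mem_direction (convexHull_subset_affineSpan _ hx)
        (convexHull_subset_affineSpan _ hx₀')
    refine ⟨φ ⟨x - x₀, hv⟩, ?_, by simp [f]⟩
    rw [mem_closedBall_zero_iff, φ.norm_map, Submodule.coe_norm, ← dist_eq_norm]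
    exact dist_le_diam_of_mem (isCompact_hull e).isBounded hx hx₀'
  calc surface d (hull e) ≤ surface d (f '' closedBall 0 (size e)) := measure_mono hsub
    _ = volume (closedBall (0 : Space (d - 1)) (size e)) := by
      rw [surface, hf.euclideanHausdorffMeasure_image,
        EuclideanSpace.euclideanHausdorffMeasure_eq_volume]
    _ = ENNReal.ofReal (B.toReal * size e ^ (d - 1)) := by
      rw [Measure.addHaar_closedBall (r := size e) _ _ diam_nonneg, finrank_euclideanSpace_fin, mul_comm,
        ENNReal.ofReal_mul ENNReal.toReal_nonneg, ENNReal.ofReal_toReal hBt]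

/-- If the diameter of `K` is at most `ν` times the inscribed diameter, then `K` lies between two
concentric balls whose radii have ratio `4ν`. -/
lemma exists_closedBall_subset_hull {ν : ℝ} (hν : 0 < ν) {K : Finset (Space d)}
    (hK : 0 < size K) (hreg : size K ≤ ν * inscribed K) :
    ∃ (c : Space d) (r : ℝ), 0 < r ∧ closedBall c r ⊆ hull K ∧ hull K ⊆ closedBall c (4 * ν * r) ∧
      size K ≤ 4 * ν * r := by
  -- The supremum need not be attained, so a ball of half the inscribed diameter is taken.
  have hins : 0 < inscribed K := pos_of_mul_pos_right (hK.trans_le hreg) hν.le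
  have hne : {δ : ℝ | ∃ (x : Space d) (r : ℝ),
      0 ≤ r ∧ δ = 2 * r ∧ closedBall x r ⊆ hull K}.Nonempty := by
    by_contra h
    -- The supremum of the empty set of reals is the junk value `0`.
    rw [Set.not_nonempty_iff_eq_empty] at h
    rw [inscribed, h, Real.sSup_empty] at hins
    exact hins.false
  obtain ⟨_, ⟨c, r, -, rfl, hsub⟩, hlt⟩ := exists_lt_of_lt_csSup hne (half_lt_self hins)
  rw [← inscribed] at hlt
  have hr : 0 < r := by linarith
  have hle : size K ≤ 4 * ν * r := by nlinarith
  refine ⟨c, r, hr, hsub, fun x hx => ?_, hle⟩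
  exact (dist_le_diam_of_mem (isCompact_hull K).isBounded hx
    (hsub (mem_closedBall_self hr.le))).trans hle

end Geometry

/-! ### The inverse trace inequality -/

section InverseTrace

variable {d m : ℕ}

lemma continuous_mul_norm_sq {F : Type*} [NormedAddCommGroup F] {f : Space d → F}
    (hf : Continuous f) (t : ℝ) : Continuous fun x => t * ‖f x‖ ^ 2 := by
  fun_prop

lemma integrableOn_hull {f : Space d → ℝ} (hf : Continuous f) {μ : Measure (Space d)}
    {e : Finset (Space d)} (he : μ (hull e) ≠ ⊤) : IntegrableOn f (hull e) μ := by
  obtain ⟨M, hM⟩ := (isCompact_hull e).exists_bound_of_continuousOn hf.continuousOn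
  exact Measure.integrableOn_of_bounded he hf.aestronglyMeasurable
    ((ae_restrict_mem (isCompact_hull e).measurableSet).mono hM)

/-- On a face of a simplex whose diameter is comparable with its inscribed diameter, the traces of
a polynomial field and of its curl, with the scaling of the energy norm, are controlled by the `L²`
norm of the field on the simplex. -/
lemma exists_face_integral_le (hd : d = 2 ∨ d = 3) (m : ℕ) {ν : ℝ} (hν : 0 < ν) :
    ∃ C : ℝ, 0 ≤ C ∧ ∀ K e : Finset (Space d), AffineIndependent ℝ (fun x : K => (x : Space d)) →
      e ⊆ K → e.card = d → size K ≤ ν * inscribed K → ∀ w : Space d → Space d, IsPolyField m w →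
      (∫ x in hull e, size e ^ 3 * ‖curl d w x‖ ^ 2 ∂(surface d)) +
        (∫ x in hull e, size e * ‖w x‖ ^ 2 ∂(surface d)) ≤ C * ∫ x in hull K, ‖w x‖ ^ 2 := by
  obtain ⟨C₀, hC₀, hball⟩ := exists_sq_le_integral_ball d m (4 * ν)
  obtain ⟨A, hA, hsurf⟩ := exists_surface_hull_le d
  set D := (4 * ν) ^ 2 * (2 * (d * (d * C₀))) + d * C₀ with hD
  refine ⟨D * A * (4 * ν) ^ d, by positivity, fun K e hind heK hcard hreg w hw => ?_⟩
  have hd0 : 1 < e.card := by rw [hcard]; omega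
  have hpos := size_pos hd0
  obtain ⟨c, r, hr, hsub, hsup, hle⟩ :=
    exists_closedBall_subset_hull hν (hpos.trans_le (size_mono heK)) hreg
  have her : size e ≤ 4 * ν * r := (size_mono heK).trans hle
  set I := ∫ x in hull K, ‖w x‖ ^ 2 with hI
  have hI0 : 0 ≤ I := integral_nonneg fun x => by positivity
  set Q := C₀ * ((r ^ d)⁻¹ * I) with hQ
  have hQ0 : 0 ≤ Q := by positivity
  have hwc : Continuous fun x => ‖w x‖ ^ 2 := hw.continuous.norm.pow 2
  have hcomp : ∀ j, C₀ * ((r ^ d)⁻¹ * ∫ x in closedBall c r, w x j ^ 2) ≤ Q := fun j => by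
    have h1 : ∫ x in closedBall c r, w x j ^ 2 ≤ I := calc
      ∫ x in closedBall c r, w x j ^ 2 ≤ ∫ x in closedBall c r, ‖w x‖ ^ 2 := by
          refine setIntegral_mono (integrableOn_of_continuous ((hw j).continuous.pow 2) _ _)
            (integrableOn_of_continuous hwc _ _) fun x => ?_
          simp only [EuclideanSpace.real_norm_sq_eq]
          exact Finset.single_le_sum (f := fun j => w x j ^ 2) (fun i _ => sq_nonneg _)
            (Finset.mem_univ j)
      _ ≤ I := setIntegral_mono_set (hwc.continuousOn.integrableOn_compact (isCompact_hull K))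
          (Filter.Eventually.of_forall fun x => by positivity)
          (LE.le.eventuallyLE hsub)
    exact mul_le_mul_of_nonneg_left (mul_le_mul_of_nonneg_left h1 (by positivity)) hC₀
  have hval : ∀ y ∈ hull e, ‖w y‖ ^ 2 ≤ d * Q := fun y hy => by
    rw [EuclideanSpace.real_norm_sq_eq]
    refine (Finset.sum_le_card_nsmul _ _ Q fun j _ => ?_).trans_eq (by simp)
    exact (hball _ (hw j) c r hr y (hsup (hull_mono heK hy))).1.trans (hcomp j)
  have hcurl : ∀ y ∈ hull e, r ^ 2 * ‖curl d w y‖ ^ 2 ≤ 2 * (d * (d * Q)) := fun y hy => by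
    have h1 : ∑ j, ∑ i, r ^ 2 * pd i (fun y => w y j) y ^ 2 ≤ d * (d * Q) := by
      refine (Finset.sum_le_card_nsmul _ _ (d * Q) fun j _ => ?_).trans_eq (by simp)
      refine (Finset.sum_le_card_nsmul _ _ Q fun i _ => ?_).trans_eq (by simp)
      exact ((hball _ (hw j) c r hr y (hsup (hull_mono heK hy))).2 i).trans (hcomp j)
    simp only [← Finset.mul_sum] at h1
    nlinarith [mul_le_mul_of_nonneg_left (norm_sq_curl_le hd w y) (sq_nonneg r)]
  have hS := hsurf e hcard (Finset.card_pos.1 (by omega)) (hind.mono (Finset.coe_subset.2 heK))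
  have hSt : surface d (hull e) ≠ ⊤ := (hS.trans_lt ENNReal.ofReal_lt_top).ne
  have hSr : (surface d).real (hull e) ≤ A * size e ^ (d - 1) :=
    ENNReal.toReal_le_of_le_ofReal (by positivity) hS
  rw [← integral_add
    (integrableOn_hull (continuous_mul_norm_sq (continuous_curl hd hw) _) hSt)
    (integrableOn_hull (continuous_mul_norm_sq hw.continuous _) hSt)]
  have hbound : ∀ y ∈ hull e, ‖size e ^ 3 * ‖curl d w y‖ ^ 2 + size e * ‖w y‖ ^ 2‖ ≤
      D * size e * ((r ^ d)⁻¹ * I) := fun y hy => by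
    rw [Real.norm_of_nonneg (by positivity)]
    have h1 : size e ^ 3 * ‖curl d w y‖ ^ 2 ≤
        size e * ((4 * ν) ^ 2 * (2 * (d * (d * Q)))) := calc
      size e ^ 3 * ‖curl d w y‖ ^ 2 = size e * (size e ^ 2 * ‖curl d w y‖ ^ 2) := by ring
      _ ≤ size e * ((4 * ν * r) ^ 2 * ‖curl d w y‖ ^ 2) := by gcongr
      _ = size e * ((4 * ν) ^ 2 * (r ^ 2 * ‖curl d w y‖ ^ 2)) := by ring
      _ ≤ _ := mul_le_mul_of_nonneg_left
          (mul_le_mul_of_nonneg_left (hcurl y hy) (sq_nonneg _)) hpos.le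
    have h2 := mul_le_mul_of_nonneg_left (hval y hy) hpos.le
    calc _ ≤ size e * ((4 * ν) ^ 2 * (2 * (d * (d * Q)))) + size e * (d * Q) := add_le_add h1 h2
      _ = _ := by rw [hD, hQ]; ring
  -- The factor `size e` is kept in the pointwise bound to make up for the exponent `d - 1` here.
  have hpow : size e * size e ^ (d - 1) = size e ^ d := by
    rw [← pow_succ', Nat.sub_add_cancel (by omega)]
  calc _ ≤ D * size e * ((r ^ d)⁻¹ * I) * (surface d).real (hull e) :=
        (le_abs_self _).trans (norm_setIntegral_le_of_norm_le_const hSt.lt_top hbound)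
    _ ≤ D * size e * ((r ^ d)⁻¹ * I) * (A * size e ^ (d - 1)) := by gcongr
    _ = D * A * ((r ^ d)⁻¹ * size e ^ d) * I := by rw [← hpow]; ring
    _ ≤ D * A * ((r ^ d)⁻¹ * (4 * ν * r) ^ d) * I := by gcongr
    _ = D * A * (4 * ν) ^ d * I := by rw [mul_pow (4 * ν) r]; field_simp

end InverseTrace

/-! ### Averages and the coercivity estimate -/

section Coercivity

variable {d m : ℕ} {Ω : Set (Space d)}

lemma Mesh.mem_faces {T : Mesh Ω} {e : Finset (Space d)} :
    e ∈ T.faces ↔ ∃ K ∈ T.cells, e ⊆ K ∧ e.card = d := by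
  simp [Mesh.faces, Finset.mem_powersetCard]

lemma Mesh.mem_adj {T : Mesh Ω} {e K : Finset (Space d)} :
    K ∈ T.adj e ↔ K ∈ T.cells ∧ e ⊆ K := by
  simp [Mesh.adj]

lemma Mesh.surface_hull_ne_top {T : Mesh Ω} (hd : 0 < d) {e : Finset (Space d)}
    (he : e ∈ T.faces) : surface d (hull e) ≠ ⊤ := by
  obtain ⟨K, hK, heK, hcard⟩ := Mesh.mem_faces.1 he
  obtain ⟨A, -, h⟩ := exists_surface_hull_le d
  exact ((h e hcard (Finset.card_pos.1 (by omega))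
    ((T.indep K hK).mono (Finset.coe_subset.2 heK))).trans_lt ENNReal.ofReal_lt_top).ne

/-- By convexity, and because the average over `k` elements carries the factor `1 / k ≤ 1`. -/
lemma norm_sq_avg_le {n : ℕ} (T : Mesh Ω) (v : Broken d (Space n)) (e : Finset (Space d))
    (x : Space d) : ‖avg T v e x‖ ^ 2 ≤ ∑ K ∈ T.adj e, ‖v K x‖ ^ 2 := by
  rw [avg, norm_smul, mul_pow, norm_inv, Real.norm_natCast]
  have h1 : ‖∑ K ∈ T.adj e, v K x‖ ^ 2 ≤ (T.adj e).card * ∑ K ∈ T.adj e, ‖v K x‖ ^ 2 :=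
    (pow_le_pow_left₀ (norm_nonneg _) (norm_sum_le _ _) 2).trans sq_sum_le_card_mul_sum_sq
  have h0 : 0 ≤ ∑ K ∈ T.adj e, ‖v K x‖ ^ 2 := Finset.sum_nonneg fun K _ => by positivity
  rcases (T.adj e).card.eq_zero_or_pos with hk | hk
  · simpa [hk] using h0
  · have hk' : (1 : ℝ) ≤ (T.adj e).card := by exact_mod_cast hk
    calc _ ≤ (((T.adj e).card : ℝ)⁻¹) ^ 2 * ((T.adj e).card * ∑ K ∈ T.adj e, ‖v K x‖ ^ 2) := by
          gcongr
      _ = ((T.adj e).card : ℝ)⁻¹ * ∑ K ∈ T.adj e, ‖v K x‖ ^ 2 := by field_simp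
      _ ≤ _ := mul_le_of_le_one_left h0 (inv_le_one_of_one_le₀ hk')

lemma continuous_avg {n : ℕ} (T : Mesh Ω) {v : Broken d (Space n)} (e : Finset (Space d))
    (hv : ∀ K ∈ T.cells, Continuous (v K)) : Continuous (avg T v e) := by
  have h : Continuous fun x => ∑ K ∈ T.adj e, v K x :=
    continuous_finsetSum _ fun K hK => hv K (Mesh.mem_adj.1 hK).1
  exact h.const_smul ((T.adj e).card : ℝ)⁻¹

lemma continuous_jump (hd : d = 2 ∨ d = 3) (T : Mesh Ω) {u : Broken d (Space d)}
    (e : Finset (Space d)) (hu : ∀ K ∈ T.cells, IsPolyField m (u K)) : Continuous (jump T u e) :=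
  continuous_finsetSum _ fun K hK =>
    continuous_cross hd (hu K (Mesh.mem_adj.1 hK).1).continuous _

lemma continuous_jumpCurl (hd : d = 2 ∨ d = 3) (T : Mesh Ω) {u : Broken d (Space d)}
    (e : Finset (Space d)) (hu : ∀ K ∈ T.cells, IsPolyField m (u K)) :
    Continuous (jumpCurl T u e) :=
  continuous_finsetSum _ fun K hK =>
    continuous_curlCross hd (continuous_curl hd (hu K (Mesh.mem_adj.1 hK).1)) _

lemma integral_avg_le {n : ℕ} (T : Mesh Ω) {v : Broken d (Space n)} {e : Finset (Space d)}
    (hv : ∀ K ∈ T.cells, Continuous (v K)) (he : surface d (hull e) ≠ ⊤) {t : ℝ} (ht : 0 ≤ t) :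
    ∫ x in hull e, t * ‖avg T v e x‖ ^ 2 ∂(surface d) ≤
      ∑ K ∈ T.adj e, ∫ x in hull e, t * ‖v K x‖ ^ 2 ∂(surface d) := by
  have hi : ∀ K ∈ T.adj e, IntegrableOn (fun x => t * ‖v K x‖ ^ 2) (hull e) (surface d) :=
    fun K hK => integrableOn_hull (continuous_mul_norm_sq (hv K (Mesh.mem_adj.1 hK).1) t) he
  rw [← integral_finsetSum _ hi]
  refine setIntegral_mono (integrableOn_hull (continuous_mul_norm_sq (continuous_avg T e hv) t) he)
    (integrable_finsetSum _ hi) fun x => ?_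
  simp only [← Finset.mul_sum]
  exact mul_le_mul_of_nonneg_left (norm_sq_avg_le T v e x) ht

open Classical in
/-- The averages of `curl³ u` and `curl² u` in the energy norm are controlled by `curl² u`: an
element contributes only to the averages on its `d + 1` faces. -/
lemma exists_avg_integral_le (hd : d = 2 ∨ d = 3) (m : ℕ) {ν : ℝ} (hν : 0 < ν) :
    ∃ C : ℝ, 0 ≤ C ∧ ∀ (Ω : Set (Space d)) (T : Mesh Ω), T.QuasiUniform ν →
      ∀ u : Broken d (Space d), (∀ K ∈ T.cells, IsPolyField m (u K)) →
      (∑ e ∈ T.faces, ∫ x in hull e, size e ^ 3 * ‖avgCurl3 T u e x‖ ^ 2 ∂(surface d)) +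
        (∑ e ∈ T.faces, ∫ x in hull e, size e * ‖avgCurl2 T u e x‖ ^ 2 ∂(surface d)) ≤
      C * ∑ K ∈ T.cells, ∫ x in hull K, ‖curl2 (u K) x‖ ^ 2 := by
  obtain ⟨C, hC, h⟩ := exists_face_integral_le hd m hν
  refine ⟨(d + 1) * C, by positivity, fun Ω T hT u hu => ?_⟩
  have hw : ∀ K ∈ T.cells, IsPolyField m (curl2 (u K)) := fun K hK => isPolyField_curl2 hd (hu K hK)
  set G : Finset (Space d) → Finset (Space d) → ℝ := fun K e =>
    (∫ x in hull e, size e ^ 3 * ‖curl3 (u K) x‖ ^ 2 ∂(surface d)) +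
      (∫ x in hull e, size e * ‖curl2 (u K) x‖ ^ 2 ∂(surface d)) with hG
  set I : Finset (Space d) → ℝ := fun K => ∫ x in hull K, ‖curl2 (u K) x‖ ^ 2 with hI
  have hI0 : ∀ K, 0 ≤ I K := fun K => integral_nonneg fun x => by positivity
  calc _ ≤ ∑ e ∈ T.faces, ∑ K ∈ T.adj e, G K e := by
        rw [← Finset.sum_add_distrib]
        refine Finset.sum_le_sum fun e he => ?_
        have hS := Mesh.surface_hull_ne_top (by omega) he
        have hs : 0 ≤ size e := diam_nonneg
        simp only [hG, Finset.sum_add_distrib]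
        exact add_le_add
          (integral_avg_le T (fun K hK => continuous_curl hd (hw K hK)) hS (by positivity))
          (integral_avg_le T (fun K hK => (hw K hK).continuous) hS hs)
    _ = ∑ K ∈ T.cells, ∑ e ∈ T.faces with e ⊆ K, G K e := by
        refine Finset.sum_comm' fun e K => ?_
        simp only [Mesh.mem_adj, Finset.mem_filter]
        tauto
    _ ≤ ∑ K ∈ T.cells, (d + 1) * C * I K := by
        refine Finset.sum_le_sum fun K hK => ?_
        have hcard : (T.faces.filter fun e => e ⊆ K).card ≤ d + 1 := by
          have hsub : (T.faces.filter fun e => e ⊆ K) ⊆ K.powersetCard d := fun e he => by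
            rw [Finset.mem_filter] at he
            obtain ⟨_, -, -, hc⟩ := Mesh.mem_faces.1 he.1
            exact Finset.mem_powersetCard.2 ⟨he.2, hc⟩
          refine (Finset.card_le_card hsub).trans_eq ?_
          rw [Finset.card_powersetCard, T.card_eq K hK, Nat.choose_succ_self_right]
        have hle : ∀ e ∈ T.faces.filter fun e => e ⊆ K, G K e ≤ C * I K := fun e he => by
          rw [Finset.mem_filter] at he
          obtain ⟨_, -, -, hc⟩ := Mesh.mem_faces.1 he.1
          exact h K e (T.indep K hK) he.2 hc (hT K hK K hK) _ (hw K hK)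
        refine (Finset.sum_le_card_nsmul _ _ _ hle).trans ?_
        rw [nsmul_eq_mul, mul_assoc]
        have : ((T.faces.filter fun e => e ⊆ K).card : ℝ) ≤ d + 1 := by exact_mod_cast hcard
        exact mul_le_mul_of_nonneg_right this (mul_nonneg hC (hI0 K))
    _ = _ := by rw [Finset.mul_sum]

lemma neg_le_two_mul_inner {F : Type*} [NormedAddCommGroup F] [InnerProductSpace ℝ F] (a b : F)
    {s : ℝ} (hs : 0 < s) : -(s * ‖b‖ ^ 2 + s⁻¹ * ‖a‖ ^ 2) ≤ 2 * inner ℝ a b := by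
  have h1 := neg_le_of_abs_le (abs_real_inner_le_norm a b)
  have h2 : 2 * (‖a‖ * ‖b‖) ≤ s * ‖b‖ ^ 2 + s⁻¹ * ‖a‖ ^ 2 := by
    have h3 : s * ‖b‖ ^ 2 + s⁻¹ * ‖a‖ ^ 2 - 2 * (‖a‖ * ‖b‖) = s⁻¹ * (s * ‖b‖ - ‖a‖) ^ 2 := by
      field_simp; ring
    have h4 : 0 ≤ s⁻¹ * (s * ‖b‖ - ‖a‖) ^ 2 := by positivity
    linarith
  linarith

/-- Young's inequality on a face: the consistency terms, weighted by `c > 0`, are absorbed by the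
averages and the jumps of the energy norm. -/
lemma neg_le_two_mul_integral_face (hd : d = 2 ∨ d = 3) (T : Mesh Ω) {u : Broken d (Space d)}
    (hu : ∀ K ∈ T.cells, IsPolyField m (u K)) {e : Finset (Space d)} (he : e ∈ T.faces) {c : ℝ}
    (hc : 0 < c) :
    -(c⁻¹ * ((∫ x in hull e, size e ^ 3 * ‖avgCurl3 T u e x‖ ^ 2 ∂(surface d)) +
          ∫ x in hull e, size e * ‖avgCurl2 T u e x‖ ^ 2 ∂(surface d)) +
        c * ((∫ x in hull e, (size e ^ 3)⁻¹ * ‖jump T u e x‖ ^ 2 ∂(surface d)) +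
          ∫ x in hull e, (size e)⁻¹ * ‖jumpCurl T u e x‖ ^ 2 ∂(surface d))) ≤
      2 * ∫ x in hull e, (inner ℝ (jump T u e x) (avgCurl3 T u e x) +
        inner ℝ (jumpCurl T u e x) (avgCurl2 T u e x)) ∂(surface d) := by
  have hS := Mesh.surface_hull_ne_top (by omega) he
  have hs : 0 < size e := by
    obtain ⟨_, -, -, hcard⟩ := Mesh.mem_faces.1 he
    exact size_pos (by omega)
  have hw : ∀ K ∈ T.cells, IsPolyField m (curl2 (u K)) := fun K hK => isPolyField_curl2 hd (hu K hK)
  have h3 : Continuous (avgCurl3 T u e) :=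
    continuous_avg T e fun K hK => continuous_curl hd (hw K hK)
  have h2 : Continuous (avgCurl2 T u e) := continuous_avg T e fun K hK => (hw K hK).continuous
  have hj := continuous_jump hd T e hu
  have hjc := continuous_jumpCurl hd T e hu
  have i3 := integrableOn_hull (continuous_mul_norm_sq h3 (size e ^ 3)) hS
  have i2 := integrableOn_hull (continuous_mul_norm_sq h2 (size e)) hS
  have ij := integrableOn_hull (continuous_mul_norm_sq hj (size e ^ 3)⁻¹) hS
  have ijc := integrableOn_hull (continuous_mul_norm_sq hjc (size e)⁻¹) hS
  have iM : IntegrableOn (fun x => c⁻¹ * (size e ^ 3 * ‖avgCurl3 T u e x‖ ^ 2 +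
      size e * ‖avgCurl2 T u e x‖ ^ 2)) (hull e) (surface d) := (i3.add i2).const_mul _
  have iJ : IntegrableOn (fun x => c * ((size e ^ 3)⁻¹ * ‖jump T u e x‖ ^ 2 +
      (size e)⁻¹ * ‖jumpCurl T u e x‖ ^ 2)) (hull e) (surface d) := (ij.add ijc).const_mul _
  rw [← integral_add i3 i2, ← integral_add ij ijc, ← integral_const_mul, ← integral_const_mul,
    ← integral_const_mul, ← integral_add iM iJ, ← integral_neg]
  refine setIntegral_mono (iM.add iJ).neg
    (integrableOn_hull (((hj.inner h3).add (hjc.inner h2)).const_mul 2) hS) fun x => ?_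
  have y3 := neg_le_two_mul_inner (jump T u e x) (avgCurl3 T u e x)
    (s := c⁻¹ * size e ^ 3) (by positivity)
  have y2 := neg_le_two_mul_inner (jumpCurl T u e x) (avgCurl2 T u e x)
    (s := c⁻¹ * size e) (by positivity)
  rw [mul_inv, inv_inv] at y3 y2
  simp only
  linarith

/-- Coercivity with explicit constants, for a broken field with polynomial restrictions. -/
lemma inv_mul_energyNormSq_le_form (hd : d = 2 ∨ d = 3) (T : Mesh Ω) {u : Broken d (Space d)}
    (hu : ∀ K ∈ T.cells, IsPolyField m (u K)) {C η : ℝ} (hC : 0 < C)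
    (havg : (∑ e ∈ T.faces, ∫ x in hull e, size e ^ 3 * ‖avgCurl3 T u e x‖ ^ 2 ∂(surface d)) +
        (∑ e ∈ T.faces, ∫ x in hull e, size e * ‖avgCurl2 T u e x‖ ^ 2 ∂(surface d)) ≤
      C * ∑ K ∈ T.cells, ∫ x in hull K, ‖curl2 (u K) x‖ ^ 2)
    (hη : 2 * C + 1 ≤ η) :
    (2 * (1 + C))⁻¹ * energyNormSq T u ≤ form T η u u := by
  set a₁ := ∑ K ∈ T.cells, ∫ x in hull K, ‖u K x‖ ^ 2 with ha₁
  set a₂ := ∑ K ∈ T.cells, ∫ x in hull K, ‖curl2 (u K) x‖ ^ 2 with ha₂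
  set j₁ := ∑ e ∈ T.faces, ∫ x in hull e, (size e ^ 3)⁻¹ * ‖jump T u e x‖ ^ 2 ∂(surface d) with hj₁
  set j₂ := ∑ e ∈ T.faces, ∫ x in hull e, (size e)⁻¹ * ‖jumpCurl T u e x‖ ^ 2 ∂(surface d) with hj₂
  set m₃ := ∑ e ∈ T.faces, ∫ x in hull e, size e ^ 3 * ‖avgCurl3 T u e x‖ ^ 2 ∂(surface d) with hm₃
  set m₂ := ∑ e ∈ T.faces, ∫ x in hull e, size e * ‖avgCurl2 T u e x‖ ^ 2 ∂(surface d) with hm₂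
  set X := ∑ e ∈ T.faces, ∫ x in hull e, (inner ℝ (jump T u e x) (avgCurl3 T u e x) +
    inner ℝ (jumpCurl T u e x) (avgCurl2 T u e x)) ∂(surface d) with hX
  have hs : ∀ e : Finset (Space d), 0 ≤ size e := fun e => diam_nonneg
  have ha₁0 : 0 ≤ a₁ := Finset.sum_nonneg fun K _ => integral_nonneg fun x => by positivity
  have hj₁0 : 0 ≤ j₁ := Finset.sum_nonneg fun e _ => integral_nonneg fun x => by
    have := hs e
    positivity
  have hj₂0 : 0 ≤ j₂ := Finset.sum_nonneg fun e _ => integral_nonneg fun x => by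
    have := hs e
    positivity
  have hX2 : -((2 * C)⁻¹ * (m₃ + m₂) + 2 * C * (j₁ + j₂)) ≤ 2 * X := by
    simp only [hm₃, hm₂, hj₁, hj₂, hX, ← Finset.sum_add_distrib, Finset.mul_sum,
      ← Finset.sum_neg_distrib]
    exact Finset.sum_le_sum fun e he =>
      neg_le_two_mul_integral_face hd T hu he (by positivity)
  have hpen : ∑ e ∈ T.faces, ∫ x in hull e,
      ((η / size e ^ 3) * inner ℝ (jump T u e x) (jump T u e x) +
        (η / size e) * inner ℝ (jumpCurl T u e x) (jumpCurl T u e x)) ∂(surface d) =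
      η * (j₁ + j₂) := by
    rw [hj₁, hj₂, ← Finset.sum_add_distrib, Finset.mul_sum]
    refine Finset.sum_congr rfl fun e he => ?_
    have hS := Mesh.surface_hull_ne_top (by omega) he
    rw [← integral_add
      (integrableOn_hull (continuous_mul_norm_sq (continuous_jump hd T e hu) _) hS)
      (integrableOn_hull (continuous_mul_norm_sq (continuous_jumpCurl hd T e hu) _) hS),
      ← integral_const_mul]
    refine integral_congr_ae (Filter.Eventually.of_forall fun x => ?_)
    simp only [real_inner_self_eq_norm_sq]
    ring
  have hform : form T η u u = a₂ + a₁ + X + X + η * (j₁ + j₂) := by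
    rw [form, hpen]
    simp only [real_inner_self_eq_norm_sq]
    rfl
  have henergy : energyNormSq T u = a₁ + a₂ + j₁ + j₂ + m₃ + m₂ := rfl
  have hm : (2 * C)⁻¹ * (m₃ + m₂) ≤ a₂ / 2 := by
    rw [inv_mul_le_iff₀ (by positivity)]
    linarith
  have hJ : (2 * C + 1) * (j₁ + j₂) ≤ η * (j₁ + j₂) :=
    mul_le_mul_of_nonneg_right hη (add_nonneg hj₁0 hj₂0)
  have hCa : 0 ≤ C * a₁ := by positivity
  have hCj : 0 ≤ C * (j₁ + j₂) := by positivity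
  rw [hform, henergy, inv_mul_le_iff₀ (by positivity)]
  calc _ ≤ 2 * (1 + C) * (a₁ + a₂ / 2 + (j₁ + j₂)) := by linarith
    _ ≤ _ := by
      refine mul_le_mul_of_nonneg_left ?_ (by positivity)
      linarith

end Coercivity

end CurlDG

theorem mainTheorem3 (d : ℕ) (hd : d = 2 ∨ d = 3) (m : ℕ) (hm : 2 ≤ m) (ν : ℝ) (hν : 0 < ν) :
    ∃ η₀ C : ℝ, 0 < η₀ ∧ 0 < C ∧
      ∀ Ω : Set (CurlDG.Space d), IsOpen Ω → Bornology.IsBounded Ω → IsConnected Ω →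
        interior (closure Ω) = Ω →
      ∀ T : CurlDG.Mesh Ω, T.QuasiUniform ν →
      ∀ s : ℕ, s ≤ T.cells.card → T.Unisolvent m s →
      ∀ η : ℝ, η₀ ≤ η →
      ∀ u ∈ T.reconstructed m s,
        C * CurlDG.energyNormSq T u ≤ CurlDG.form T η u u := by
  obtain ⟨C, hC, h⟩ := CurlDG.exists_avg_integral_le hd m hν
  -- `C + 1` replaces `C`, which may vanish.
  refine ⟨2 * (C + 1) + 1, (2 * (1 + (C + 1)))⁻¹, by positivity, by positivity, ?_⟩
  intro Ω _ _ _ _ T hT s _ _ η hη u hu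
  obtain ⟨g, hg⟩ := hu
  have hpoly : ∀ K ∈ T.cells, CurlDG.IsPolyField m (u K) := fun K hK => (hg K hK).1
  refine CurlDG.inv_mul_energyNormSq_le_form hd T hpoly (by positivity) ?_ hη
  refine (h Ω T hT u hpoly).trans (mul_le_mul_of_nonneg_right (by linarith) ?_)
  exact Finset.sum_nonneg fun K _ => MeasureTheory.integral_nonneg fun x => by positivity
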